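/- **Setting and notation.** All vector spaces are real. For a normed space $(E,\|\cdot\|_E)$ let $E'$ denote its dual. Let $B\subset E$ be non-empty and convex, $H:=\operatorname{span}B$, $\operatorname{cone}B:=\{ax: a\ge 0,\ x\in B\}$, let $\Gamma:B\to\mathbb R$ be a map, and let $I$ be the interior of $\Gamma(B)$ in $\mathbb R$. For $x_\star\in B$ put $A:=-x_\star+B$ and $F:=\operatorname{span}A$. Consider the following conditions. - (B1) There is a $\varphi'\in E'$ with $B\subset\{\varphi'=1\}$. - (B2) There are an $x_\star\in B$ and a norm $\|\cdot\|_F$ on $F$ with $\|\cdot\|_E\le\|\cdot\|_F$ on $F$. - (B2*) (B2) holds, and $0$ is an interior point of $A$ in $(F,\|\cdot\|_F)$. - (B3) There is a $K>0$ such that every $z\in H$ can be written as $z=z^+-z^-$ with $z^\pm\in\operatorname{cone}B$ and $\|z^-\|_E+\|z^+\|_E\le K\|z\|_E$. - (B4) $H$ is dense in $E$. - (B5) $E$ is a Banach space and $E'$ is separable. - (G1*) $\Gamma$ is $\|\cdot\|_E$-continuous, and $\{\Gamma=r\}$ is convex for every $r\in\Gamma(B)$. - (G2) For all $r\in I$,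 $\varepsilon>0$ and $x\in\{\Gamma=r\}$ there are $x^-\in\{\Gamma<r\}$ and $x^+\in\{\Gamma>r\}$ with $\|x-x^-\|_H\le\varepsilon$ and $\|x-x^+\|_H\le\varepsilon$. Here, under (B1) and (B2), $H=F\oplus\mathbb R x_\star$, and $\|y+a x_\star\|_H:=\|y\|_F+\|a x_\star\|_E$ for $y\in F$, $a\in\mathbb R$. - (G4) $B_0:=\Gamma^{-1}(I)$ is a Borel subset of $E$. A family $(z_r')_{r\in I}$ of linear functionals is called *separating for $\Gamma$* if for all $r\in I$ $$\{\Gamma<r\}=\{z_r'<0\}\cap B,\qquad \{\Gamma=r\}=\{z_r'=0\}\cap B,\qquad \{\Gamma>r\}=\{z_r'>0\}\cap B .$$ A family $(\hat z_r')_{r\in I}\subset E'$ is called *the normalized separating family in $E'$* if there is exactly one separating family $(z_r')_{r\in I}$ of continuous functionals of norm one on $(H,\|\cdot\|_E)$ and if, for every $r\in I$, $\hat z_r'$ is the only functional in $E'$ of norm one that extends $z_r'$. Let $\hat{\mathcal B}(I)$ be the Lebesgue completion of the Borel $\sigma$-algebra of $I$. **Corollary 3.2.** Assume that (B1), (B2*),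 (B3), (B4), (G1*) and (G2) are satisfied for $E$, $B$, $\varphi'$, $(F,\|\cdot\|_F)$ and $\Gamma$. In addition, let $E_0\hookrightarrow E$ be a continuously embedded Banach space with $B\subset E_0$ such that (B2), (B3), (B4), (B5), (G1*) and (G4) are satisfied for $E_0$ in place of $E$, with the same $B$ and $\Gamma$ and the same normed space $(F,\|\cdot\|_F)$. Then the normalized separating families $(\hat z_r')_{r\in I}$ in $E'$ and $(\hat z_{0,r}')_{r\in I}$ in $E_0'$ exist. The map $r\mapsto \hat z_{0,r}'$, $I\to E_0'$, is measurable with respect to $\hat{\mathcal B}(I)$ and the Borel $\sigma$-algebra of $E_0'$, and it is also measurable in the sense of Bochner integration theory, i.e. it is a pointwise limit of $\hat{\mathcal B}(I)$-measurable functions $I\to E_0'$ with finitely many values. Moreover, there is an $\hat{\mathcal B}(I)$-measurable map $\alpha:I\to\mathbb R$ such that for all $r\in I$ $$\alpha(r)>0\qquad\text{and}\qquad (\hat z_r')_{|E_0}=\alpha(r)\,\hat z_{0,r}' .$$ -/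

import Mathlib

open Set MeasureTheory

/-!
Conventions. A functional `Γ` on a subset `B` of a space `V` is given by a total function `V → ℝ`
of which only the values on `B` are ever used. Likewise the norm on the subspace `F` is given by a
total function `V → ℝ` of which only the values on `F` are ever used.
-/

namespace SepFam

section Notions

variable {V : Type*} [NormedAddCommGroup V] [NormedSpace ℝ V]

/-- The index set `I`: the interior (in `ℝ`) of the image `Γ(B)`. -/
def levelRange (B : Set V) (Γ : V → ℝ) : Set ℝ := interior (Γ '' B)

/-- The shiftedSet `A = -x⋆ + B`. -/
def shiftedSet (B : Set V) (xs : V) : Set V := (fun x => -xs + x) '' B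

/-- The space `F = span A = span (-x⋆ + B)`. -/
def dirSpace (B : Set V) (xs : V) : Submodule ℝ V := Submodule.span ℝ (shiftedSet B xs)

/-- `N` is a norm on the subspace `F` (non-negativity follows from these axioms). -/
structure IsNormOn (F : Submodule ℝ V) (N : V → ℝ) : Prop where
  add_le : ∀ x ∈ F, ∀ y ∈ F, N (x + y) ≤ N x + N y
  smul_eq : ∀ (c : ℝ), ∀ x ∈ F, N (c • x) = |c| * N x
  eq_zero : ∀ x ∈ F, N x = 0 → x = 0

/-- The cone `{a • x : a ≥ 0, x ∈ B}` generated by `B`. -/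
def coneOf (B : Set V) : Set V := {z | ∃ a : ℝ, 0 ≤ a ∧ ∃ x ∈ B, z = a • x}

/-- Simplex face: `B ⊆ {φ = 1}`. -/
def SimplexFace (B : Set V) (φ : StrongDual ℝ V) : Prop := ∀ x ∈ B, φ x = 1

/-- Dominating norm: `x⋆ ∈ B`, and `N` is a norm on `F = span (-x⋆ + B)` with `‖·‖ ≤ N`. -/
structure DominatingNorm (B : Set V) (xs : V) (N : V → ℝ) : Prop where
  mem : xs ∈ B
  isNorm : IsNormOn (dirSpace B xs) N
  le : ∀ y ∈ dirSpace B xs, ‖y‖ ≤ N y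

/-- Non-empty relative interior: in addition, `0` is an interior point of `A = -x⋆ + B` in the
normed space `(F, N)`. -/
structure DominatingNormInterior (B : Set V) (xs : V) (N : V → ℝ) : Prop
    extends DominatingNorm B xs N where
  zero_mem_interior : ∃ ε > 0, ∀ y ∈ dirSpace B xs, N y < ε → y ∈ shiftedSet B xs

/-- Cone decomposition in `H = span B`. -/
def ConeDecomposition (B : Set V) : Prop :=
  ∃ K : ℝ, 0 < K ∧ ∀ z ∈ Submodule.span ℝ B, ∃ zm ∈ coneOf B, ∃ zp ∈ coneOf B,
    z = zp - zm ∧ ‖zm‖ + ‖zp‖ ≤ K * ‖z‖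

/-- Denseness of `H = span B`. -/
def SpanDense (B : Set V) : Prop := Dense (Submodule.span ℝ B : Set V)

/-- `Γ` is norm-continuous on `B` and its level sets are convex. -/
structure ContinuousConvexLevels (B : Set V) (Γ : V → ℝ) : Prop where
  continuousOn : ContinuousOn Γ B
  convex_level : ∀ r ∈ Γ '' B, Convex ℝ {x | x ∈ B ∧ Γ x = r}

/-- The norm `‖y + a x⋆‖_H = N y + ‖a x⋆‖` on `H = F ⊕ ℝ x⋆`. Since `φ = 0` on `F` and
`φ x⋆ = 1`, the coordinate `a` of `z = y + a x⋆` is `φ z`; see `hNorm_add_smul`. -/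
def hNorm (φ : StrongDual ℝ V) (xs : V) (N : V → ℝ) (z : V) : ℝ :=
  N (z - φ z • xs) + ‖φ z • xs‖

/-- `Γ` is locally non-constant with respect to the norm of `H`. -/
def LocallyNonconstant (B : Set V) (φ : StrongDual ℝ V) (xs : V) (N : V → ℝ) (Γ : V → ℝ) : Prop :=
  ∀ r ∈ levelRange B Γ, ∀ ε > 0, ∀ x ∈ B, Γ x = r →
    ∃ xm ∈ B, ∃ xp ∈ B, Γ xm < r ∧ r < Γ xp ∧
      hNorm φ xs N (x - xm) ≤ ε ∧ hNorm φ xs N (x - xp) ≤ ε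

/-- `B₀ = Γ⁻¹(I)` is a Borel subset of the space. -/
def BorelPreimage (B : Set V) (Γ : V → ℝ) : Prop :=
  MeasurableSet[borel V] {x | x ∈ B ∧ Γ x ∈ levelRange B Γ}

/-- `(z r)_{r ∈ I}` separates `Γ`; it is used with `I = levelRange B Γ`. -/
def IsSeparatingFamily (B : Set V) (Γ : V → ℝ) {I : Set ℝ} (z : I → V →ₗ[ℝ] ℝ) : Prop :=
  ∀ r : I,
    {x | x ∈ B ∧ Γ x < r} = {x | z r x < 0} ∩ B ∧
    {x | x ∈ B ∧ Γ x = r} = {x | z r x = 0} ∩ B ∧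
    {x | x ∈ B ∧ r < Γ x} = {x | 0 < z r x} ∩ B

/-- A separating family of continuous functionals of norm one. -/
def IsUnitSeparatingFamily (B : Set V) (Γ : V → ℝ) {I : Set ℝ} (z : I → StrongDual ℝ V) : Prop :=
  IsSeparatingFamily B Γ (fun r => (z r : V →ₗ[ℝ] ℝ)) ∧ ∀ r, ‖z r‖ = 1

/-- `zh` is *the* normalized separating family in the dual of `V`: on `H = span B`, with the norm
of `V`, there is exactly one separating family `z` of continuous functionals of norm one, and each
`zh r` is the one and only functional of norm one on `V` that extends `z r`. -/
def IsTheSeparatingFamily (B : Set V) (Γ : V → ℝ) {I : Set ℝ} (zh : I → StrongDual ℝ V) : Prop :=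
  ∃ z : I → StrongDual ℝ (Submodule.span ℝ B),
    IsUnitSeparatingFamily (Subtype.val ⁻¹' B) (Γ ∘ Subtype.val) z ∧
    (∀ w : I → StrongDual ℝ (Submodule.span ℝ B),
      IsUnitSeparatingFamily (Subtype.val ⁻¹' B) (Γ ∘ Subtype.val) w → w = z) ∧
    ∀ r, ((zh r).comp (Submodule.span ℝ B).subtypeL = z r ∧ ‖zh r‖ = 1) ∧
      ∀ y : StrongDual ℝ V, y.comp (Submodule.span ℝ B).subtypeL = z r → ‖y‖ = 1 → y = zh r

end Notions

/-- The completion, with respect to Lebesgue measure on `I`, of the Borel σ-algebra of `I ⊆ ℝ`: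
the sets that agree with a Borel set up to a Lebesgue null set. It is used for
the open set `I = levelRange B Γ`. -/
@[reducible] noncomputable def lebesgueCompletion (I : Set ℝ) : MeasurableSpace I :=
  eventuallyMeasurableSpace (inferInstance : MeasurableSpace I)
    (ae (Measure.comap Subtype.val (volume : Measure ℝ)))

theorem measurableSet_lebesgueCompletion (I : Set ℝ) (s : Set I) :
    MeasurableSet[lebesgueCompletion I] s ↔
      NullMeasurableSet s (Measure.comap Subtype.val (volume : Measure ℝ)) :=
  Iff.rfl

/-- On `F ⊕ ℝ x⋆` the function `hNorm` is given by the usual formula. -/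
theorem hNorm_add_smul {V : Type*} [NormedAddCommGroup V] [NormedSpace ℝ V]
    {B : Set V} {φ : StrongDual ℝ V} {xs : V} (N : V → ℝ) (hφ : SimplexFace B φ) (hxs : xs ∈ B)
    {y : V} (hy : y ∈ dirSpace B xs) (a : ℝ) :
    hNorm φ xs N (y + a • xs) = N y + ‖a • xs‖ := by
  have h0 : φ y = 0 := by
    have hle : dirSpace B xs ≤ LinearMap.ker (φ : V →ₗ[ℝ] ℝ) := by
      refine Submodule.span_le.2 ?_
      rintro _ ⟨x, hx, rfl⟩
      simp [hφ x hx, hφ xs hxs]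
    simpa using hle hy
  have h1 : φ (y + a • xs) = a := by simp [h0, hφ xs hxs]
  unfold hNorm
  rw [h1, add_sub_cancel_right]

/-- Passing to a subspace that contains `B` does not change the index set. -/
theorem levelRange_preimage {V W : Type*} [NormedAddCommGroup V] [NormedSpace ℝ V]
    [NormedAddCommGroup W] [NormedSpace ℝ W] (f : W → V) (B : Set V) (hB : B ⊆ range f)
    (Γ : V → ℝ) : levelRange (f ⁻¹' B) (Γ ∘ f) = levelRange B Γ := by
  unfold levelRange
  rw [image_comp, image_preimage_eq_of_subset hB]

end SepFam

/-!
Existence. Since `Γ` is continuous with convex level sets, the intermediate value theorem makes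
`{Γ < r}` and `{r < Γ}` convex. Inside `A = -x⋆ + B`, which has interior points for the norm `N`
of `F`, Hahn–Banach separates the interiors of these two sets by a closed hyperplane. Interior
points are dense in a convex set, and local non-constancy puts each point of `{Γ = r}` in the
closure of both sides, so the hyperplane contains `{Γ = r}`; sliding along segments shows that it
contains no other point of `A` (`exists_affine_separation`). With `φ = 1` on `B` the affine
functional becomes a linear one, so that an algebraic functional on `E` has the sign of `Γ - r`
on `B` (`exists_separates`).

Such a functional is automatically continuous on `span B` for every norm in which `Γ` is
continuous and cones decompose: if it were large on small elements `u` of the cone over `B`, then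
points `(1 - φ u) x + u` near a point `x` with `Γ x < r` would satisfy `r < Γ`
(`Separates.exists_bound`). It is unique up to a positive factor, because zeros on segments
determine the ratios of its values (`Separates.exists_pos_mul_eq`). Together with the density of
`span B` this yields the normalized separating families of `E` and of `E₀`
(`exists_isTheSeparatingFamily`), and it makes the two families proportional on `E₀`.

Measurability is elementary, and gives Borel measurability in `r`. For `u` in `span B` the set of
those `r` with `z r u > 0` is open (`isOpen_setOf_pos`): writing `u = a₁ b₁ - a₂ b₂`, a common
cone element `v` moves `a₁ b₁ + v` into `{r < Γ}` and `a₂ b₂ + v` into `{Γ < r}`, and both remain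
there for nearby `r`. As `z r` has norm one, `z r p < c` with `c > 0` means that
`z r (c u - ‖u‖ p) > 0` for some `u`, so that `r ↦ max (z r p) 0` is upper semicontinuous and
`r ↦ z r p` is Borel (`measurable_apply`). In a separable dual, measurability against all vectors
implies strong measurability (`stronglyMeasurable_of_measurable_apply`). The factor is
`α r = ‖z r ∘ ι‖`.
-/

namespace SepFam

/-! ### Functions with convex level sets and separation in a normed space -/

section Quasilinear

variable {G : Type*} [AddCommGroup G] [Module ℝ G] [TopologicalSpace G] [ContinuousAdd G]
  [ContinuousSMul ℝ G]

/-- A segment between two points of `{g < r}` through a point outside would meet some level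
`s < r` on both sides of that point, against the convexity of the level set. -/
theorem convex_setOf_lt_of_convex_levels {S : Set G} {g : G → ℝ} (hS : Convex ℝ S)
    (hg : ContinuousOn g S) (hlev : ∀ s ∈ g '' S, Convex ℝ {x | x ∈ S ∧ g x = s}) (r : ℝ) :
    Convex ℝ {x | x ∈ S ∧ g x < r} := by
  rintro x ⟨hx, hxr⟩ y ⟨hy, hyr⟩ a b ha hb hab
  refine ⟨hS hx hy ha hb hab, ?_⟩
  by_contra! hcon
  set w := a • x + b • y with hw
  obtain ⟨s, hs, hsr⟩ := exists_between (max_lt hxr hyr)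
  have hwS : w ∈ S := hS hx hy ha hb hab
  have key : ∀ v ∈ S, g v < s → ∃ v' ∈ segment ℝ v w, g v' = s := by
    intro v hv hvs
    have hsub : segment ℝ v w ⊆ S := hS.segment_subset hv hwS
    exact (convex_segment v w).isPreconnected.intermediate_value
      (left_mem_segment ℝ v w) (right_mem_segment ℝ v w) (hg.mono hsub)
      ⟨hvs.le, (hsr.trans_le hcon).le⟩
  obtain ⟨x', hx', hxs⟩ := key x hx ((le_max_left _ _).trans_lt hs)
  obtain ⟨y', hy', hys⟩ := key y hy ((le_max_right _ _).trans_lt hs)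
  have hx'S := hS.segment_subset hx hwS hx'
  have hy'S := hS.segment_subset hy hwS hy'
  have hmem : w ∈ segment ℝ x' y' := by
    obtain ⟨a₁, c₁, ha₁, hc₁, h₁, rfl⟩ := hx'
    obtain ⟨a₂, c₂, ha₂, hc₂, h₂, rfl⟩ := hy'
    have e₁ : c₁ = 1 - a₁ := by linarith
    have e₂ : c₂ = 1 - a₂ := by linarith
    have eb : b = 1 - a := by linarith
    subst e₁ e₂ eb
    -- the weights solve `p * a₁ * b = q * a₂ * a`, which makes the combination return to `w`
    have hD : 0 < a * a₂ + (1 - a) * a₁ := by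
      rcases ha₁.eq_or_lt with h | h
      · subst h
        simp only [zero_smul, sub_zero, one_smul, zero_add] at hxs
        linarith
      rcases ha₂.eq_or_lt with h' | h'
      · subst h'
        simp only [zero_smul, sub_zero, one_smul, zero_add] at hys
        linarith
      rcases ha.eq_or_lt with h'' | h''
      · subst h''; simpa using h
      · have := mul_pos h'' h'
        nlinarith [mul_nonneg hb ha₁]
    refine ⟨a * a₂ / (a * a₂ + (1 - a) * a₁), (1 - a) * a₁ / (a * a₂ + (1 - a) * a₁),
      by positivity, by positivity, ?_, ?_⟩
    · rw [← add_div, div_self hD.ne']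
    · rw [hw]
      match_scalars <;> field_simp <;> ring
  have := (hlev s ⟨x', hx'S, hxs⟩).segment_subset ⟨hx'S, hxs⟩ ⟨hy'S, hys⟩ hmem
  linarith [this.2]

theorem convex_setOf_gt_of_convex_levels {S : Set G} {g : G → ℝ} (hS : Convex ℝ S)
    (hg : ContinuousOn g S) (hlev : ∀ s ∈ g '' S, Convex ℝ {x | x ∈ S ∧ g x = s}) (r : ℝ) :
    Convex ℝ {x | x ∈ S ∧ r < g x} := by
  have := convex_setOf_lt_of_convex_levels (g := fun x => -g x) hS hg.neg (by
    rintro _ ⟨x, hx, rfl⟩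
    simpa using hlev (g x) ⟨x, hx, rfl⟩) (-r)
  simpa using this

end Quasilinear

theorem exists_lt_and_gt_of_mem_interior {T : Set ℝ} {r : ℝ} (hr : r ∈ interior T) :
    (∃ s ∈ T, s < r) ∧ ∃ s ∈ T, r < s := by
  obtain ⟨ε, hε, h⟩ := Metric.mem_nhds_iff.1 (mem_interior_iff_mem_nhds.1 hr)
  refine ⟨⟨r - ε / 2, h ?_, by linarith⟩, ⟨r + ε / 2, h ?_, by linarith⟩⟩ <;>
  · rw [Metric.mem_ball, Real.dist_eq]
    norm_num [abs_of_pos (half_pos hε), hε]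

/-- If, in addition to having convex level sets, `g` is locally non-constant at the level `r`,
then a closed hyperplane cuts out `{g = r}` exactly, not only weakly. -/
theorem exists_affine_separation {G : Type*} [NormedAddCommGroup G] [NormedSpace ℝ G]
    {S : Set G} {g : G → ℝ} (hS : Convex ℝ S) (hint : (interior S).Nonempty)
    (hg : ContinuousOn g S) (hlev : ∀ s ∈ g '' S, Convex ℝ {x | x ∈ S ∧ g x = s}) {r : ℝ}
    (hr : r ∈ interior (g '' S))
    (hlt : ∀ x ∈ S, g x = r → x ∈ closure {y | y ∈ S ∧ g y < r})
    (hgt : ∀ x ∈ S, g x = r → x ∈ closure {y | y ∈ S ∧ r < g y}) :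
    ∃ (f : StrongDual ℝ G) (c : ℝ), ∀ x ∈ S,
      (g x < r ↔ f x < c) ∧ (r < g x ↔ c < f x) := by
  have hgi : ContinuousOn g (interior S) := hg.mono interior_subset
  -- points of a relatively open set `g ⁻¹' T` are limits of interior points of `S` in that set
  have hS' : S ⊆ closure (interior S) := by
    rw [hS.closure_interior_eq_closure_of_nonempty_interior hint]
    exact subset_closure
  have hcl : ∀ T : Set ℝ, IsOpen T → ∀ x ∈ S, g x ∈ T → x ∈ closure (interior S ∩ g ⁻¹' T) := by
    intro T hT x hx hxT
    have h1 : g ⁻¹' T ∈ nhdsWithin x (interior S) :=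
      nhdsWithin_mono x interior_subset (hg x hx (hT.mem_nhds hxT))
    have h2 : (nhdsWithin x (interior S)).NeBot := mem_closure_iff_nhdsWithin_neBot.1 (hS' hx)
    rw [mem_closure_iff_nhdsWithin_neBot, nhdsWithin_inter_of_mem' h1]
    exact h2
  have hcU : Convex ℝ (interior S ∩ g ⁻¹' Iio r) := by
    have h := hS.interior.inter (convex_setOf_lt_of_convex_levels hS hg hlev r)
    rwa [show interior S ∩ {x | x ∈ S ∧ g x < r} = interior S ∩ g ⁻¹' Iio r from
      Set.ext fun x => ⟨fun h => ⟨h.1, h.2.2⟩, fun h => ⟨h.1, interior_subset h.1, h.2⟩⟩] at h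
  have hcV : Convex ℝ (interior S ∩ g ⁻¹' Ioi r) := by
    have h := hS.interior.inter (convex_setOf_gt_of_convex_levels hS hg hlev r)
    rwa [show interior S ∩ {x | x ∈ S ∧ r < g x} = interior S ∩ g ⁻¹' Ioi r from
      Set.ext fun x => ⟨fun h => ⟨h.1, h.2.2⟩, fun h => ⟨h.1, interior_subset h.1, h.2⟩⟩] at h
  obtain ⟨f, c, hfU, hfV⟩ := geometric_hahn_banach_open_open hcU
    (hgi.isOpen_inter_preimage isOpen_interior isOpen_Iio) hcV
    (hgi.isOpen_inter_preimage isOpen_interior isOpen_Ioi)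
    (disjoint_left.2 fun x hx hx' => lt_asymm (show g x < r from hx.2) hx'.2)
  have hle : ∀ x ∈ S, g x < r → f x ≤ c := fun x hx hxr =>
    closure_minimal (fun y hy => (hfU y hy).le) (isClosed_le f.continuous continuous_const)
      (hcl (Iio r) isOpen_Iio x hx hxr)
  have hge : ∀ x ∈ S, r < g x → c ≤ f x := fun x hx hxr =>
    closure_minimal (fun y hy => (hfV y hy).le) (isClosed_le continuous_const f.continuous)
      (hcl (Ioi r) isOpen_Ioi x hx hxr)
  have heq : ∀ x ∈ S, g x = r → f x = c := fun x hx hxr => le_antisymm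
    (closure_minimal (fun y hy => hle y hy.1 hy.2)
      (isClosed_le f.continuous continuous_const) (hlt x hx hxr))
    (closure_minimal (fun y hy => hge y hy.1 hy.2)
      (isClosed_le continuous_const f.continuous) (hgt x hx hxr))
  obtain ⟨⟨_, ⟨p, hp, rfl⟩, hpr⟩, ⟨_, ⟨q, hq, rfl⟩, hqr⟩⟩ := exists_lt_and_gt_of_mem_interior hr
  obtain ⟨p', hp'⟩ := closure_nonempty_iff.1 ⟨p, hcl (Iio r) isOpen_Iio p hp hpr⟩
  obtain ⟨q', hq'⟩ := closure_nonempty_iff.1 ⟨q, hcl (Ioi r) isOpen_Ioi q hq hqr⟩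
  -- a point of `S` near `x` on the segment towards `y` has the same sign of `g - r` as `x`
  have hnear : ∀ T : Set ℝ, IsOpen T → ∀ x ∈ S, g x ∈ T → ∀ y ∈ S,
      ∃ t : ℝ, 0 < t ∧ x + t • (y - x) ∈ S ∧ g (x + t • (y - x)) ∈ T := by
    intro T hT x hx hxT y hy
    have hcont : Filter.Tendsto (fun t : ℝ => x + t • (y - x)) (nhdsWithin 0 (Ioc 0 1))
        (nhdsWithin x S) := by
      refine tendsto_nhdsWithin_iff.2 ⟨?_, ?_⟩
      · have : Continuous fun t : ℝ => x + t • (y - x) := by fun_prop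
        simpa using (this.tendsto 0).mono_left nhdsWithin_le_nhds
      · filter_upwards [self_mem_nhdsWithin] with t ht
        exact hS.add_smul_sub_mem hx hy ⟨ht.1.le, ht.2⟩
    have hev := hcont.eventually (hg x hx (hT.mem_nhds hxT))
    have : (nhdsWithin (0 : ℝ) (Ioc 0 1)).NeBot := by
      rw [nhdsWithin_Ioc_eq_nhdsGT zero_lt_one]; infer_instance
    obtain ⟨t, ht, ht'⟩ := (hev.and self_mem_nhdsWithin).exists
    exact ⟨t, ht'.1, hS.add_smul_sub_mem hx hy ⟨ht'.1.le, ht'.2⟩, ht⟩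
  -- a point of `{g < r}` on the hyperplane could be moved slightly towards `q'`, across it
  have hlt' : ∀ x ∈ S, g x < r → f x < c := by
    intro x hx hxr
    refine lt_of_le_of_ne (hle x hx hxr) fun h => ?_
    have hqS := interior_subset hq'.1
    obtain ⟨t, ht, hmem, hgt⟩ := hnear (Iio r) isOpen_Iio x hx hxr q' hqS
    have h1 := hle _ hmem hgt
    have h2 := hfV q' hq'
    simp only [map_add, map_smul, map_sub, smul_eq_mul, h] at h1
    nlinarith [mul_pos ht (sub_pos.2 h2)]
  have hgt' : ∀ x ∈ S, r < g x → c < f x := by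
    intro x hx hxr
    refine lt_of_le_of_ne (hge x hx hxr) fun h => ?_
    have hpS := interior_subset hp'.1
    obtain ⟨t, ht, hmem, hgt⟩ := hnear (Ioi r) isOpen_Ioi x hx hxr p' hpS
    have h1 := hge _ hmem hgt
    have h2 := hfU p' hp'
    simp only [map_add, map_smul, map_sub, smul_eq_mul, ← h] at h1
    nlinarith [mul_pos ht (sub_pos.2 h2)]
  refine ⟨f, c, fun x hx => ?_⟩
  rcases lt_trichotomy (g x) r with h | h | h
  · have := hlt' x hx h
    exact ⟨iff_of_true h this, iff_of_false h.not_gt this.not_gt⟩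
  · have := heq x hx h
    simp [h, this]
  · have := hgt' x hx h
    exact ⟨iff_of_false h.not_gt this.not_gt, iff_of_true h this⟩

/-! ### Linear functionals with the sign of `Γ - r`: uniqueness and continuity -/

section Separates

variable {V : Type*} [NormedAddCommGroup V] [NormedSpace ℝ V]

/-- The functional `z` has, on `B`, the sign of `Γ - r`: the condition at a single level `r` that
makes up `IsSeparatingFamily`. The equality `{Γ = r} = {z = 0} ∩ B` follows by trichotomy. -/
def Separates (B : Set V) (Γ : V → ℝ) (r : ℝ) (z : V →ₗ[ℝ] ℝ) : Prop :=
  ∀ x ∈ B, (Γ x < r ↔ z x < 0) ∧ (r < Γ x ↔ 0 < z x)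

variable {B : Set V} {Γ : V → ℝ} {r : ℝ} {z w : V →ₗ[ℝ] ℝ} {φ : StrongDual ℝ V}

theorem isSeparatingFamily_iff {I : Set ℝ} {z : I → V →ₗ[ℝ] ℝ} :
    IsSeparatingFamily B Γ z ↔ ∀ r : I, Separates B Γ r (z r) := by
  refine forall_congr' fun r => ⟨fun ⟨h₁, _, h₃⟩ x hx => ⟨?_, ?_⟩, fun h => ⟨?_, ?_, ?_⟩⟩
  · simpa [hx] using Set.ext_iff.1 h₁ x
  · simpa [hx] using Set.ext_iff.1 h₃ x
  · ext x
    exact ⟨fun hx => ⟨(h x hx.1).1.1 hx.2, hx.1⟩, fun hx => ⟨hx.2, (h x hx.2).1.2 hx.1⟩⟩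
  · ext x
    simp only [mem_ofPred_eq, mem_inter_iff, and_comm (a := x ∈ B), and_congr_left_iff]
    intro hx
    have := h x hx
    rcases lt_trichotomy (Γ x) r with h' | h' | h' <;>
    rcases lt_trichotomy (z r x) 0 with h'' | h'' | h'' <;>
    grind
  · ext x
    exact ⟨fun hx => ⟨(h x hx.1).2.1 hx.2, hx.1⟩, fun hx => ⟨hx.2, (h x hx.2).2.2 hx.1⟩⟩

theorem Separates.neg (hz : Separates B Γ r z) : Separates B (fun x => -Γ x) (-r) (-z) :=
  fun x hx => by simpa using (hz x hx).symm

theorem Separates.smul (hz : Separates B Γ r z) {c : ℝ} (hc : 0 < c) :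
    Separates B Γ r (c • z) :=
  fun x hx => by simpa [mul_neg_iff, hc, hc.not_gt] using hz x hx

theorem Separates.congr (hz : Separates B Γ r z) (h : ∀ x ∈ B, w x = z x) :
    Separates B Γ r w :=
  fun x hx => by simpa [h x hx] using hz x hx

theorem Separates.comp {W : Type*} [NormedAddCommGroup W] [NormedSpace ℝ W]
    (hz : Separates B Γ r z) (f : W →ₗ[ℝ] V) : Separates (f ⁻¹' B) (Γ ∘ f) r (z ∘ₗ f) :=
  fun x hx => hz (f x) hx

theorem Separates.eq_zero_iff (hz : Separates B Γ r z) {x : V} (hx : x ∈ B) :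
    z x = 0 ↔ Γ x = r := by
  have := hz x hx
  grind

/-- Two functionals that separate at the same level vanish at the same point of the segment from
`x` to `y`, which determines the ratio of the values at `x` and `y`. -/
theorem Separates.mul_eq_mul (hB : Convex ℝ B) (hz : Separates B Γ r z) (hw : Separates B Γ r w)
    {x y : V} (hx : x ∈ B) (hy : y ∈ B) (hxr : z x < 0) (hyr : 0 < z y) :
    z y * w x = z x * w y := by
  have hd : 0 < z y - z x := by linarith
  have hmem : (z y / (z y - z x)) • x + (-z x / (z y - z x)) • y ∈ B :=
    hB hx hy (by positivity) (div_nonneg (by linarith) hd.le) (by field_simp; ring)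
  have h0 : z ((z y / (z y - z x)) • x + (-z x / (z y - z x)) • y) = 0 := by
    simp only [map_add, map_smul, smul_eq_mul]
    ring
  have h1 := (hw.eq_zero_iff hmem).2 ((hz.eq_zero_iff hmem).1 h0)
  simp only [map_add, map_smul, smul_eq_mul] at h1
  field_simp at h1
  linarith

/-- A functional that separates at a level is determined on `span B` up to a positive factor. -/
theorem Separates.exists_pos_mul_eq (hB : Convex ℝ B) (hz : Separates B Γ r z)
    (hw : Separates B Γ r w) (hlt : ∃ x ∈ B, Γ x < r) (hgt : ∃ x ∈ B, r < Γ x) :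
    ∃ c > 0, ∀ u ∈ Submodule.span ℝ B, w u = c * z u := by
  obtain ⟨x, hx, hxr⟩ := hlt
  obtain ⟨y, hy, hyr⟩ := hgt
  have hzx := (hz x hx).1.1 hxr
  have hwx := (hw x hx).1.1 hxr
  have hzy := (hz y hy).2.1 hyr
  have hxy := hz.mul_eq_mul hB hw hx hy hzx hzy
  refine ⟨w x / z x, div_pos_of_neg_of_neg hwx hzx, fun u hu => ?_⟩
  refine LinearMap.eqOn_span (f := w) (g := (w x / z x) • z) (fun b hb => ?_) hu
  simp only [LinearMap.smul_apply, smul_eq_mul]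
  rcases lt_trichotomy (z b) 0 with h | h | h
  · have := hz.mul_eq_mul hB hw hb hy h hzy
    have hzx' := hzx.ne
    field_simp
    have : z y * (w b * z x - w x * z b) = 0 := by linear_combination z x * this - z b * hxy
    have := (mul_eq_zero.1 this).resolve_left hzy.ne'
    linarith
  · rw [h, mul_zero, hw.eq_zero_iff hb, ← hz.eq_zero_iff hb, h]
  · have := hz.mul_eq_mul hB hw hx hb hzx h
    have hzx' := hzx.ne
    field_simp
    linarith

/-- For small `u` in the cone over `B` the point `(1 - φ u) • x + u` lies in `B` and is close to
`x`; if `Γ x < r`, then `Γ < r` there too, which bounds `z u` from above. -/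
theorem Separates.exists_bound_above (hB : Convex ℝ B) (hφ : SimplexFace B φ)
    (hΓ : ContinuousOn Γ B) (hz : Separates B Γ r z) (hlt : ∃ x ∈ B, Γ x < r) :
    ∃ δ > 0, ∃ M, ∀ u ∈ coneOf B, ‖u‖ ≤ δ → z u ≤ M := by
  obtain ⟨x, hx, hxr⟩ := hlt
  have hzx := (hz x hx).1.1 hxr
  obtain ⟨δ, hδ, hball⟩ := Metric.mem_nhdsWithin_iff.1 (hΓ x hx (Iio_mem_nhds hxr))
  have hK : 0 < 1 + ‖φ‖ * ‖x‖ := by positivity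
  refine ⟨min (1 / (‖φ‖ + 1)) (δ / (2 * (1 + ‖φ‖ * ‖x‖))), by positivity, -z x, ?_⟩
  rintro u ⟨a, ha, b, hb, rfl⟩ hu
  have haφ : a ≤ ‖φ‖ * ‖a • b‖ := by
    have := φ.le_opNorm (a • b)
    rwa [map_smul, hφ b hb, smul_eq_mul, mul_one, Real.norm_of_nonneg ha] at this
  have h1 : ‖a • b‖ * (‖φ‖ + 1) ≤ 1 := (le_div_iff₀ (by positivity)).1 (hu.trans (min_le_left _ _))
  have h2 : ‖a • b‖ * (2 * (1 + ‖φ‖ * ‖x‖)) ≤ δ :=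
    (le_div_iff₀ (by positivity)).1 (hu.trans (min_le_right _ _))
  have ha1 : a ≤ 1 := by nlinarith [norm_nonneg (a • b)]
  have hmem : (1 - a) • x + a • b ∈ B := hB hx hb (by linarith) ha (by ring)
  have hdist : dist ((1 - a) • x + a • b) x < δ := by
    have e : (1 - a) • x + a • b - x = a • b - a • x := by module
    rw [dist_eq_norm, e]
    have hax : ‖a • x‖ ≤ ‖φ‖ * ‖a • b‖ * ‖x‖ := by
      rw [norm_smul a x, Real.norm_of_nonneg ha]
      gcongr
    have := norm_sub_le (a • b) (a • x)
    nlinarith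
  have h3 := (hz _ hmem).1.1 (hball ⟨hdist, hmem⟩)
  rw [map_add, map_smul z (1 - a), smul_eq_mul] at h3
  nlinarith

theorem Separates.exists_bound (hB : Convex ℝ B) (hφ : SimplexFace B φ)
    (hcone : ConeDecomposition B) (hΓ : ContinuousOn Γ B) (hz : Separates B Γ r z)
    (hlt : ∃ x ∈ B, Γ x < r) (hgt : ∃ x ∈ B, r < Γ x) :
    ∃ C, ∀ u ∈ Submodule.span ℝ B, |z u| ≤ C * ‖u‖ := by
  obtain ⟨δ₁, hδ₁, M₁, h₁⟩ := hz.exists_bound_above hB hφ hΓ hlt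
  obtain ⟨δ₂, hδ₂, M₂, h₂⟩ := hz.neg.exists_bound_above hB hφ hΓ.neg (by simpa using hgt)
  obtain ⟨K, hK, hdec⟩ := hcone
  set δ := min δ₁ δ₂
  set M := max M₁ M₂
  have hδ : 0 < δ := lt_min hδ₁ hδ₂
  have hsmall : ∀ u ∈ coneOf B, ‖u‖ ≤ δ → |z u| ≤ M := by
    intro u hu hn
    have h₁' := h₁ u hu (hn.trans (min_le_left _ _))
    have h₂' := h₂ u hu (hn.trans (min_le_right _ _))
    rw [LinearMap.neg_apply] at h₂'
    exact abs_le.2 ⟨by linarith [le_max_right M₁ M₂], h₁'.trans (le_max_left _ _)⟩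
  have hbd : ∀ u ∈ coneOf B, |z u| ≤ M / δ * ‖u‖ := by
    intro u hu
    rcases eq_or_ne u 0 with rfl | hu0
    · simp
    have hn : 0 < ‖u‖ := norm_pos_iff.2 hu0
    obtain ⟨a, ha, b, hb, rfl⟩ := hu
    have := hsmall ((δ / ‖a • b‖) • a • b) ⟨δ / ‖a • b‖ * a, by positivity, b, hb, by
      rw [smul_smul]⟩ (by
        rw [norm_smul, Real.norm_of_nonneg (by positivity), div_mul_cancel₀ _ hn.ne'])
    rw [map_smul z (δ / ‖a • b‖), smul_eq_mul, abs_mul, abs_of_pos (by positivity)] at this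
    rw [div_mul_eq_mul_div, le_div_iff₀ hδ]
    rw [div_mul_eq_mul_div, div_le_iff₀ hn] at this
    linarith
  have hMδ : 0 ≤ M / δ := by
    obtain ⟨x, hx, -⟩ := hlt
    have := (abs_nonneg _).trans (hsmall 0 ⟨0, le_rfl, x, hx, by simp⟩ (by simpa using hδ.le))
    positivity
  refine ⟨M / δ * K, fun u hu => ?_⟩
  obtain ⟨m, hm, p, hp, rfl, hle⟩ := hdec u hu
  calc |z (p - m)| ≤ |z p| + |z m| := by rw [map_sub]; exact abs_sub _ _
    _ ≤ M / δ * ‖p‖ + M / δ * ‖m‖ := add_le_add (hbd p hp) (hbd m hm)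
    _ = M / δ * (‖m‖ + ‖p‖) := by ring
    _ ≤ M / δ * (K * ‖p - m‖) := by gcongr
    _ = _ := by ring

/-! ### The normalized separating family -/

theorem eq_of_eqOn_span (hd : SpanDense B) {f g : StrongDual ℝ V}
    (h : ∀ u ∈ Submodule.span ℝ B, f u = g u) : f = g :=
  DFunLike.coe_injective (f.continuous.ext_on hd g.continuous h)

theorem norm_pos_smul {W : Type*} [NormedAddCommGroup W] [NormedSpace ℝ W] {c : ℝ} (hc : 0 < c)
    (f : StrongDual ℝ W) : ‖c • f‖ = c * ‖f‖ := by
  rw [norm_smul, Real.norm_of_nonneg hc.le]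

theorem exists_pos_norm_smul_eq_one {W : Type*} [NormedAddCommGroup W] [NormedSpace ℝ W]
    {f : StrongDual ℝ W} (hf : f ≠ 0) : ∃ c : ℝ, 0 < c ∧ ‖c • f‖ = 1 := by
  have h : 0 < ‖f‖ := norm_pos_iff.2 hf
  exact ⟨‖f‖⁻¹, inv_pos.2 h, by rw [norm_pos_smul (inv_pos.2 h), inv_mul_cancel₀ h.ne']⟩

/-- Algebraic separating functionals at all levels, with no continuity assumed, suffice for the
existence of the normalized separating family. -/
theorem exists_isTheSeparatingFamily {I : Set ℝ} (hB : Convex ℝ B) (hφ : SimplexFace B φ)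
    (hcone : ConeDecomposition B) (hd : SpanDense B) (hΓ : ContinuousOn Γ B)
    (hI : ∀ r : I, (∃ x ∈ B, Γ x < r) ∧ ∃ x ∈ B, r < Γ x) {ζ : I → V →ₗ[ℝ] ℝ}
    (hζ : ∀ r : I, Separates B Γ r (ζ r)) :
    ∃ z : I → StrongDual ℝ V, IsTheSeparatingFamily B Γ z ∧
      (∀ r : I, Separates B Γ r (z r : V →ₗ[ℝ] ℝ)) ∧ ∀ r, ‖z r‖ = 1 := by
  have key : ∀ r : I, ∃ f : StrongDual ℝ (Submodule.span ℝ B), ∃ g : StrongDual ℝ V,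
      Separates B Γ r (g : V →ₗ[ℝ] ℝ) ∧ g.comp (Submodule.span ℝ B).subtypeL = f ∧
      ‖f‖ = 1 ∧ ‖g‖ = 1 := by
    intro r
    obtain ⟨C, hC⟩ := (hζ r).exists_bound hB hφ hcone hΓ (hI r).1 (hI r).2
    set f₀ : StrongDual ℝ (Submodule.span ℝ B) :=
      (ζ r ∘ₗ (Submodule.span ℝ B).subtype).mkContinuous C (fun u => hC u u.2) with hf₀
    have hf₀' : ∀ u, f₀ u = ζ r u := fun u => rfl
    have hne : f₀ ≠ 0 := by
      obtain ⟨x, hx, hxr⟩ := (hI r).1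
      intro h
      have h1 := (hζ r x hx).1.1 hxr
      have h2 := hf₀' ⟨x, Submodule.subset_span hx⟩
      rw [h] at h2
      exact h1.ne h2.symm
    obtain ⟨c, hpos, hn⟩ := exists_pos_norm_smul_eq_one hne
    obtain ⟨g, hg, hgn⟩ := exists_extension_norm_eq _ (c • f₀)
    refine ⟨c • f₀, g, ?_, ?_, hn, hgn.trans hn⟩
    · exact ((hζ r).smul hpos).congr fun x hx => hg ⟨x, Submodule.subset_span hx⟩
    · ext u
      exact hg u
  choose f g hsep hres hf hg using key
  refine ⟨g, ⟨f, ⟨isSeparatingFamily_iff.2 fun r => ?_, hf⟩, ?_, ?_⟩, hsep, hg⟩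
  · rw [← hres r]
    exact (hsep r).comp (Submodule.span ℝ B).subtype
  · rintro w ⟨hw, hwn⟩
    funext r
    have hfs : Separates (Subtype.val ⁻¹' B) (Γ ∘ Subtype.val) r
        (f r : Submodule.span ℝ B →ₗ[ℝ] ℝ) := by
      rw [← hres r]
      exact (hsep r).comp (Submodule.span ℝ B).subtype
    obtain ⟨⟨x, hx, hxr⟩, ⟨y, hy, hyr⟩⟩ := hI r
    obtain ⟨c, hc, hcw⟩ := hfs.exists_pos_mul_eq
      (hB.linear_preimage (Submodule.span ℝ B).subtype) (isSeparatingFamily_iff.1 hw r)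
      ⟨⟨x, Submodule.subset_span hx⟩, hx, hxr⟩ ⟨⟨y, Submodule.subset_span hy⟩, hy, hyr⟩
    have hcw' : w r = c • f r := by
      ext u
      refine hcw u ?_
      rw [Submodule.coe_subtype, Submodule.span_span_coe_preimage]
      trivial
    have := hwn r
    rw [hcw', norm_pos_smul hc, hf, mul_one] at this
    rw [hcw', this, one_smul]
  · refine fun r => ⟨⟨hres r, hg r⟩, fun y hy _ => eq_of_eqOn_span hd fun u hu => ?_⟩
    exact congrArg (fun h : StrongDual ℝ (Submodule.span ℝ B) => h ⟨u, hu⟩)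
      (hy.trans (hres r).symm)

/-! ### Dependence of the separating functionals on the level -/

/-- The sign of `z r u` is lower semicontinuous in the level `r`, also for `u` outside `B`; no
normalization of `z r` is involved. -/
theorem isOpen_setOf_pos {I : Set ℝ} (hB : Convex ℝ B) (hcone : ConeDecomposition B)
    (hI : ∀ r : I, (∃ x ∈ B, Γ x < r) ∧ ∃ x ∈ B, r < Γ x) {z : I → V →ₗ[ℝ] ℝ}
    (hz : ∀ r : I, Separates B Γ r (z r)) {u : V} (hu : u ∈ Submodule.span ℝ B) :
    IsOpen {r : I | 0 < z r u} := by
  obtain ⟨K, -, hdec⟩ := hcone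
  obtain ⟨_, ⟨a₂, ha₂, b₂, hb₂, rfl⟩, _, ⟨a₁, ha₁, b₁, hb₁, rfl⟩, rfl, -⟩ := hdec u hu
  rw [isOpen_iff_mem_nhds]
  intro r hr
  obtain ⟨⟨x, hx, hxr⟩, ⟨y, hy, hyr⟩⟩ := hI r
  have hzx := (hz r x hx).1.1 hxr
  have hzy := (hz r y hy).2.1 hyr
  simp only [mem_ofPred_eq, map_sub, map_smul, smul_eq_mul] at hr
  obtain ⟨t, ht₂, ht₁⟩ := exists_between (sub_pos.1 hr)
  -- a vector `m • v` of the open cone over `B` on which `z r` takes the value `-t`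
  obtain ⟨m, hm, v, hv, hmv⟩ : ∃ m : ℝ, 0 < m ∧ ∃ v ∈ B, m * z r v = -t := by
    obtain ⟨s, hs⟩ : ∃ s : ℝ, s = (|t| + 1) / (-z r x) := ⟨_, rfl⟩
    have hs0 : 0 < s := hs ▸ div_pos (by positivity) (by linarith)
    have hsx : s * z r x = -(|t| + 1) := by
      rw [hs]; field_simp [hzx.ne]
    obtain ⟨q, hq⟩ : ∃ q : ℝ, q = (-t + (|t| + 1)) / z r y := ⟨_, rfl⟩
    have hq0 : 0 < q := hq ▸ div_pos (by linarith [le_abs_self t]) hzy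
    have hqy : q * z r y = -t + (|t| + 1) := by rw [hq]; field_simp
    refine ⟨q + s, by positivity, (q / (q + s)) • y + (s / (q + s)) • x,
      hB hy hx (by positivity) (by positivity) (by field_simp), ?_⟩
    simp only [map_add, map_smul, smul_eq_mul]
    field_simp
    linarith
  have hmem : ∀ a : ℝ, 0 ≤ a → ∀ b ∈ B, (a / (a + m)) • b + (m / (a + m)) • v ∈ B :=
    fun a ha b hb => hB hb hv (by positivity) (by positivity) (by field_simp)
  have hval : ∀ (r' : I) (a : ℝ), 0 ≤ a → ∀ b,
      (a + m) * z r' ((a / (a + m)) • b + (m / (a + m)) • v) = a * z r' b + m * z r' v := by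
    intro r' a ha b
    simp only [map_add, map_smul, smul_eq_mul]
    field_simp
  have hm₁ := hmem a₁ ha₁ b₁ hb₁
  have hm₂ := hmem a₂ ha₂ b₂ hb₂
  have hv₁ := fun r' => hval r' a₁ ha₁ b₁
  have hv₂ := fun r' => hval r' a₂ ha₂ b₂
  set p₁ := (a₁ / (a₁ + m)) • b₁ + (m / (a₁ + m)) • v
  set p₂ := (a₂ / (a₂ + m)) • b₂ + (m / (a₂ + m)) • v
  have hp₁ : 0 < a₁ + m := by positivity
  have hp₂ : 0 < a₂ + m := by positivity
  have h₁ : (r : ℝ) < Γ p₁ := (hz r p₁ hm₁).2.2 (by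
    have := hv₁ r
    exact pos_of_mul_pos_right (a := a₁ + m) (by linarith) hp₁.le)
  have h₂ : Γ p₂ < r := (hz r p₂ hm₂).1.2 (by
    have := hv₂ r
    by_contra! h
    have := mul_nonneg hp₂.le h
    linarith)
  have hopen : IsOpen {r' : I | Γ p₂ < r' ∧ r' < Γ p₁} :=
    (isOpen_lt continuous_const continuous_subtype_val).inter
      (isOpen_lt continuous_subtype_val continuous_const)
  filter_upwards [hopen.mem_nhds ⟨h₂, h₁⟩] with r' hr'
  have e₁ := mul_pos hp₁ ((hz r' p₁ hm₁).2.1 hr'.2)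
  have e₂ := mul_pos hp₂ (neg_pos.2 ((hz r' p₂ hm₂).1.1 hr'.1))
  have := hv₁ r'
  have := hv₂ r'
  change 0 < z r' (a₁ • b₁ - a₂ • b₂)
  simp only [map_sub, map_smul, smul_eq_mul]
  linarith

/-- For functionals of norm one, `z r p < c` holds if and only if `z r p * ‖u‖ < c * z r u` for
some `u` in the dense subspace, which is a condition on the sign of `z r` at `c • u - ‖u‖ • p`. -/
theorem isOpen_setOf_lt {I : Set ℝ} (hd : SpanDense B) {z : I → StrongDual ℝ V}
    (hopen : ∀ u ∈ Submodule.span ℝ B, IsOpen {r : I | 0 < z r u}) (hn : ∀ r, ‖z r‖ = 1)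
    {p : V} (hp : p ∈ Submodule.span ℝ B) {c : ℝ} (hc : 0 < c) :
    IsOpen {r : I | z r p < c} := by
  have : {r : I | z r p < c} =
      ⋃ u ∈ Submodule.span ℝ B, {r : I | 0 < z r (c • u - ‖u‖ • p)} := by
    ext r
    simp only [mem_ofPred_eq, mem_iUnion, exists_prop, map_sub, map_smul, smul_eq_mul, sub_pos]
    constructor
    · intro h
      by_contra! hcon
      have hk : max (z r p / c) 0 < 1 := max_lt ((div_lt_one hc).2 h) one_pos
      have hb : ∀ u ∈ Submodule.span ℝ B, z r u ≤ max (z r p / c) 0 * ‖u‖ := by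
        intro u hu
        have h1 : z r u ≤ z r p / c * ‖u‖ := by
          rw [div_mul_eq_mul_div, le_div_iff₀ hc]
          linarith [hcon u hu]
        exact h1.trans (by gcongr; exact le_max_left _ _)
      have hb' : ∀ u, z r u ≤ max (z r p / c) 0 * ‖u‖ := fun u =>
        (isClosed_le (z r).continuous (by fun_prop)).closure_subset_iff.2 hb (hd u)
      have := (z r).opNorm_le_bound (le_max_right (z r p / c) 0) fun u =>
        abs_le.2 ⟨by have := hb' (-u); rw [map_neg, norm_neg] at this; linarith, hb' u⟩
      linarith [hn r]
    · rintro ⟨u, -, h⟩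
      have h1 : z r u ≤ ‖u‖ := by
        have := (z r).le_opNorm u
        rw [hn, one_mul] at this
        exact (le_abs_self _).trans this
      rcases (norm_nonneg u).eq_or_lt with h0 | h0
      · rw [norm_eq_zero.1 h0.symm] at h
        simp at h
      · have : ‖u‖ * z r p < ‖u‖ * c := by nlinarith
        exact lt_of_mul_lt_mul_left this h0.le
  rw [this]
  refine isOpen_biUnion fun u hu => hopen _ ?_
  exact sub_mem (Submodule.smul_mem _ _ hu) (Submodule.smul_mem _ _ hp)

theorem measurable_apply {I : Set ℝ} (hd : SpanDense B) {z : I → StrongDual ℝ V}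
    (hopen : ∀ u ∈ Submodule.span ℝ B, IsOpen {r : I | 0 < z r u}) (hn : ∀ r, ‖z r‖ = 1)
    (p : V) : Measurable fun r : I => z r p := by
  have hpos : ∀ p ∈ Submodule.span ℝ B, Measurable fun r : I => max (z r p) 0 := by
    intro p hp
    refine measurable_of_Iio fun c => ?_
    rcases le_or_gt c 0 with hc | hc
    · convert MeasurableSet.empty
      ext r
      simp [hc]
    · convert (isOpen_setOf_lt hd hopen hn hp hc).measurableSet using 1
      ext r
      simp [hc]
  have hspan : ∀ p ∈ Submodule.span ℝ B, Measurable fun r : I => z r p := by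
    intro p hp
    have := (hpos p hp).sub (hpos (-p) (neg_mem hp))
    convert this using 2 with r
    simp only [Pi.sub_apply, map_neg]
    exact (max_zero_sub_eq_self (z r p)).symm
  obtain ⟨u, hu, hlim⟩ := mem_closure_iff_seq_limit.1 (hd p)
  exact measurable_of_tendsto_metrizable (fun n => hspan (u n) (hu n))
    (tendsto_pi_nhds.2 fun r => ((z r).continuous.tendsto p).comp hlim)

end Separates

/-! ### Measurable maps into a separable dual -/

theorem measurable_of_measurable_norm_sub {Ω X : Type*} [MeasurableSpace Ω]
    [NormedAddCommGroup X] [TopologicalSpace.SeparableSpace X] [MeasurableSpace X] [BorelSpace X]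
    {f : Ω → X} (hf : ∀ x, Measurable fun ω => ‖f ω - x‖) : Measurable f := by
  have := UniformSpace.secondCountable_of_separable X
  have hb : ∀ x r, MeasurableSet (f ⁻¹' Metric.ball x r) := fun x r => by
    have := hf x (measurableSet_Iio (a := r))
    convert this using 1
    ext ω
    simp [dist_eq_norm]
  refine measurable_of_isOpen fun U hU => ?_
  choose! ρ hρ hρU using Metric.isOpen_iff.1 hU
  obtain ⟨T, hTU, hT, hUT⟩ := TopologicalSpace.isOpen_biUnion_countable U
    (fun x => Metric.ball x (ρ x)) fun x _ => Metric.isOpen_ball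
  have : U = ⋃ x ∈ T, Metric.ball x (ρ x) := by
    rw [hUT]
    exact (iUnion₂_subset hρU).antisymm' fun x hx =>
      mem_biUnion hx (Metric.mem_ball_self (hρ x hx))
  rw [this, preimage_iUnion₂]
  exact MeasurableSet.biUnion hT fun x _ => hb x _

/-- The norm of a separable dual space is determined by countably many vectors: take an almost
norming vector of the unit ball for each member of a dense sequence of functionals. -/
theorem exists_countable_norming (V : Type*) [NormedAddCommGroup V] [NormedSpace ℝ V]
    [TopologicalSpace.SeparableSpace (StrongDual ℝ V)] :
    ∃ u : ℕ × ℕ → V, ∀ (g : StrongDual ℝ V) (c : ℝ), ‖g‖ ≤ c ↔ ∀ i, ‖g (u i)‖ ≤ c := by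
  have hex : ∀ i : ℕ × ℕ, ∃ u : V, ‖u‖ < 1 ∧
      ‖TopologicalSpace.denseSeq (StrongDual ℝ V) i.1‖ - 1 / ((i.2 : ℝ) + 1) <
        ‖TopologicalSpace.denseSeq (StrongDual ℝ V) i.1 u‖ := fun i =>
    ContinuousLinearMap.exists_lt_apply_of_lt_opNorm _
      (sub_lt_self _ Nat.one_div_pos_of_nat)
  choose u hu hlt using hex
  refine ⟨u, fun g c => ⟨fun h i => ?_, fun h => ?_⟩⟩
  · calc ‖g (u i)‖ ≤ ‖g‖ * ‖u i‖ := g.le_opNorm _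
      _ ≤ ‖g‖ * 1 := by gcongr; exact (hu i).le
      _ ≤ c := by rwa [mul_one]
  · refine le_of_forall_pos_le_add fun ε hε => ?_
    obtain ⟨n, hn⟩ := (TopologicalSpace.denseRange_denseSeq (StrongDual ℝ V)).exists_dist_lt g
      (div_pos hε three_pos)
    obtain ⟨k, hk⟩ := exists_nat_one_div_lt (div_pos hε three_pos)
    have h1 := hlt (n, k)
    have h2 := h (n, k)
    rw [dist_eq_norm] at hn
    set d := TopologicalSpace.denseSeq (StrongDual ℝ V) n
    have h3 : ‖d (u (n, k))‖ ≤ ‖g (u (n, k))‖ + ‖g - d‖ := by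
      have h4 : ‖(g - d) (u (n, k))‖ ≤ ‖g - d‖ := (g - d).le_of_opNorm_le_of_le le_rfl
        (hu (n, k)).le |>.trans (mul_one _).le
      have h5 := norm_sub_le (g (u (n, k))) ((g - d) (u (n, k)))
      rw [sub_apply, sub_sub_cancel] at h5
      exact h5.trans (by rw [← sub_apply]; gcongr)
    have h6 : ‖g‖ ≤ ‖g - d‖ + ‖d‖ := by simpa using norm_add_le (g - d) d
    simp only at h1
    linarith

theorem measurable_norm_of_measurable_apply {Ω V : Type*} [MeasurableSpace Ω]
    [NormedAddCommGroup V] [NormedSpace ℝ V] [TopologicalSpace.SeparableSpace (StrongDual ℝ V)]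
    {f : Ω → StrongDual ℝ V} (hf : ∀ u, Measurable fun ω => f ω u) :
    Measurable fun ω => ‖f ω‖ := by
  obtain ⟨u, hu⟩ := exists_countable_norming V
  refine measurable_of_Iic fun c => ?_
  have : (fun ω => ‖f ω‖) ⁻¹' Iic c = ⋂ i, {ω | ‖f ω (u i)‖ ≤ c} := by
    ext ω
    simp [hu (f ω) c]
  rw [this]
  exact MeasurableSet.iInter fun i => measurableSet_le (hf (u i)).norm measurable_const

/-- A form of Pettis' theorem: in a separable dual, weak-star measurability implies strong
measurability. -/
theorem stronglyMeasurable_of_measurable_apply {Ω V : Type*} [MeasurableSpace Ω]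
    [NormedAddCommGroup V] [NormedSpace ℝ V] [TopologicalSpace.SeparableSpace (StrongDual ℝ V)]
    {f : Ω → StrongDual ℝ V} (hf : ∀ u, Measurable fun ω => f ω u) : StronglyMeasurable f := by
  have := UniformSpace.secondCountable_of_separable (StrongDual ℝ V)
  borelize (StrongDual ℝ V)
  exact (measurable_of_measurable_norm_sub fun g => measurable_norm_of_measurable_apply
    (f := fun ω => f ω - g) fun u => (hf u).sub measurable_const).stronglyMeasurable

/-! ### Separating functionals on `E` -/

section DirNormed

variable {E : Type*} [NormedAddCommGroup E] [NormedSpace ℝ E]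

/-- The subspace `F` of `E`, as a type that carries the norm `N` instead of the norm of `E`. -/
def DirNormed (F : Submodule ℝ E) (N : E → ℝ) (_ : IsNormOn F N) : Type _ := F

variable {F : Submodule ℝ E} {N : E → ℝ} {h : IsNormOn F N}

instance : AddCommGroup (DirNormed F N h) := inferInstanceAs (AddCommGroup F)

instance : Module ℝ (DirNormed F N h) := inferInstanceAs (Module ℝ F)

/-- The inclusion of `(F, N)` into `E`. -/
def DirNormed.incl (F : Submodule ℝ E) (N : E → ℝ) (h : IsNormOn F N) :
    DirNormed F N h →ₗ[ℝ] E :=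
  F.subtype

theorem DirNormed.incl_mem (y : DirNormed F N h) : DirNormed.incl F N h y ∈ F :=
  Subtype.property (p := (· ∈ F)) y

instance : Norm (DirNormed F N h) := ⟨fun y => N (DirNormed.incl F N h y)⟩

theorem DirNormed.norm_def (y : DirNormed F N h) : ‖y‖ = N (DirNormed.incl F N h y) := rfl

theorem IsNormOn.nonneg (h : IsNormOn F N) {x : E} (hx : x ∈ F) : 0 ≤ N x := by
  have h1 := h.add_le x hx (-x) (neg_mem hx)
  have h2 := h.smul_eq (-1) x hx
  have h3 := h.smul_eq 0 x hx
  simp only [neg_smul, one_smul, abs_neg, abs_one, one_mul, zero_smul, abs_zero, zero_mul] at h2 h3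
  rw [add_neg_cancel, h2, h3] at h1
  linarith

theorem DirNormed.core (h : IsNormOn F N) : NormedSpace.Core ℝ (DirNormed F N h) where
  norm_nonneg y := h.nonneg y.incl_mem
  norm_smul c y := by
    rw [norm_def, map_smul, h.smul_eq c _ y.incl_mem, Real.norm_eq_abs, norm_def]
  norm_triangle x y := by
    rw [norm_def, map_add]
    exact h.add_le _ x.incl_mem _ y.incl_mem
  norm_eq_zero_iff y := by
    refine ⟨fun hy => Subtype.ext (h.eq_zero _ y.incl_mem hy), ?_⟩
    rintro rfl
    simpa [norm_def] using h.smul_eq 0 0 F.zero_mem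

noncomputable instance : NormedAddCommGroup (DirNormed F N h) :=
  NormedAddCommGroup.ofCore (DirNormed.core h)

noncomputable instance : NormedSpace ℝ (DirNormed F N h) :=
  NormedSpace.ofCore (DirNormed.core h)

end DirNormed

variable {E : Type*} [NormedAddCommGroup E] [NormedSpace ℝ E] {B : Set E} {φ : StrongDual ℝ E}
  {xs : E} {N : E → ℝ} {Γ : E → ℝ}

theorem sub_mem_dirSpace {x y : E} (hx : x ∈ B) (hy : y ∈ B) : x - y ∈ dirSpace B xs := by
  have h : ∀ z ∈ B, -xs + z ∈ dirSpace B xs := fun z hz => Submodule.subset_span ⟨z, hz, rfl⟩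
  have := sub_mem (h x hx) (h y hy)
  rwa [add_sub_add_left_eq_sub] at this

/-- The separation takes place in `(F, N)`, where `-x⋆ + B` has an interior point; the
functional obtained on `E` need not be continuous. -/
theorem exists_separates (hB : Convex ℝ B) (hface : SimplexFace B φ)
    (hnorm : DominatingNormInterior B xs N) (hlevel : ContinuousConvexLevels B Γ)
    (hloc : LocallyNonconstant B φ xs N Γ) {r : ℝ} (hr : r ∈ levelRange B Γ) :
    ∃ ζ : E →ₗ[ℝ] ℝ, Separates B Γ r ζ := by
  set j := DirNormed.incl (dirSpace B xs) N hnorm.isNorm with hj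
  have hjc : Continuous j := AddMonoidHomClass.continuous_of_bound j 1 fun y => by
    rw [one_mul]
    exact hnorm.le _ y.incl_mem
  -- the affine parametrization `y ↦ y + xs` of `B` by the normed space `(F, N)`
  set T : DirNormed (dirSpace B xs) N hnorm.isNorm →ᵃ[ℝ] E :=
    j.toAffineMap + AffineMap.const ℝ _ xs with hT
  have hTa : ∀ y, T y = j y + xs := fun y => rfl
  have hTc : Continuous T := by
    have : Continuous fun y => j y + xs := hjc.add continuous_const
    exact this
  -- every point of `B` is the image of a point of `F`
  have hlift : ∀ x ∈ B, ∃ y, T y = x := fun x hx =>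
    ⟨⟨x - xs, sub_mem_dirSpace hx hnorm.mem⟩, sub_add_cancel x xs⟩
  have himg : (Γ ∘ T) '' (T ⁻¹' B) = Γ '' B := by
    rw [image_comp, image_preimage_eq_of_subset fun x hx => hlift x hx]
  have hdist : ∀ y y', T y ∈ B → T y' ∈ B → hNorm φ xs N (T y - T y') = dist y y' := by
    intro y y' hy hy'
    have h0 : φ (T y - T y') = 0 := by rw [map_sub, hface _ hy, hface _ hy', sub_self]
    rw [hNorm, h0, zero_smul, norm_zero, sub_zero, add_zero, dist_eq_norm, DirNormed.norm_def,
      hTa, hTa, add_sub_add_right_eq_sub, ← map_sub]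
  have hclosure : ∀ (P : ℝ → Prop), (∀ ε > 0, ∀ x ∈ B, Γ x = r →
      ∃ x' ∈ B, P (Γ x') ∧ hNorm φ xs N (x - x') ≤ ε) → ∀ y ∈ T ⁻¹' B, (Γ ∘ T) y = r →
      y ∈ closure {y' | y' ∈ T ⁻¹' B ∧ P ((Γ ∘ T) y')} := by
    intro P hP y hy hyr
    refine Metric.mem_closure_iff.2 fun ε hε => ?_
    obtain ⟨x', hx', hPx, hle⟩ := hP (ε / 2) (half_pos hε) (T y) hy hyr
    obtain ⟨y', rfl⟩ := hlift x' hx'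
    rw [hdist y y' hy hx'] at hle
    exact ⟨y', ⟨hx', hPx⟩, by linarith⟩
  have hint : (0 : DirNormed (dirSpace B xs) N hnorm.isNorm) ∈ interior (T ⁻¹' B) := by
    obtain ⟨ε, hε, h⟩ := hnorm.zero_mem_interior
    rw [mem_interior_iff_mem_nhds]
    refine Filter.mem_of_superset (Metric.ball_mem_nhds 0 hε) fun y hy => ?_
    rw [mem_ball_zero_iff, DirNormed.norm_def] at hy
    obtain ⟨x, hx, hxy⟩ := h _ y.incl_mem hy
    have : T y = x := by rw [hTa, hj, ← hxy]; exact neg_add_cancel_comm xs x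
    rwa [mem_preimage, this]
  obtain ⟨f, c, hf⟩ := exists_affine_separation (S := T ⁻¹' B) (g := Γ ∘ T) (r := r)
    (hB.affine_preimage T) ⟨0, hint⟩
    (hlevel.continuousOn.comp hTc.continuousOn fun y hy => hy)
    (fun s hs => (hlevel.convex_level s (himg ▸ hs)).affine_preimage T) (himg.symm ▸ hr)
    (hclosure (· < r) fun ε hε x hx hxr => by
      obtain ⟨x', hx', -, -, h, -, h', -⟩ := hloc r hr ε hε x hx hxr
      exact ⟨x', hx', h, h'⟩)
    (hclosure (r < ·) fun ε hε x hx hxr => by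
      obtain ⟨-, -, x', hx', -, h, -, h'⟩ := hloc r hr ε hε x hx hxr
      exact ⟨x', hx', h, h'⟩)
  obtain ⟨π, hπ⟩ := j.exists_leftInverse_of_injective
    (LinearMap.ker_eq_bot.2 (Submodule.subtype_injective _))
  -- an algebraic extension of `f` from `F` to `E`
  set ψ : E →ₗ[ℝ] ℝ := (f : DirNormed (dirSpace B xs) N hnorm.isNorm →ₗ[ℝ] ℝ) ∘ₗ π
  -- on `B`, where `φ = 1`, this functional is `f - c` after translation by `-xs`
  refine ⟨ψ - (ψ xs + c) • (φ : E →ₗ[ℝ] ℝ), fun x hx => ?_⟩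
  obtain ⟨y, rfl⟩ := hlift x hx
  have h1 : ψ (j y) = f y := congrArg f (LinearMap.congr_fun hπ y)
  have h2 : (ψ - (ψ xs + c) • (φ : E →ₗ[ℝ] ℝ)) (T y) = f y - c := by
    simp only [LinearMap.sub_apply, LinearMap.smul_apply, ContinuousLinearMap.coe_coe,
      hface _ hx, smul_eq_mul, mul_one]
    rw [hTa, map_add, h1]
    ring
  rw [h2, sub_neg, sub_pos]
  exact hf y hx

end SepFam

open SepFam

theorem corollary3p2
    {E : Type*} [NormedAddCommGroup E] [NormedSpace ℝ E]
    -- the continuously embedded Banach space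
    {E₀ : Type*} [NormedAddCommGroup E₀] [NormedSpace ℝ E₀] [CompleteSpace E₀]
    (ι : E₀ →L[ℝ] E) (hι : Function.Injective ι)
    (B : Set E) (hBne : B.Nonempty) (hBconv : Convex ℝ B) (hBE₀ : B ⊆ Set.range ι)
    (φ : StrongDual ℝ E) (xs : E) (N : E → ℝ) (Γ : E → ℝ)
    -- the assumptions on `E`
    (hface : SepFam.SimplexFace B φ)
    (hnorm : SepFam.DominatingNormInterior B xs N)
    (hcone : SepFam.ConeDecomposition B)
    (hdense : SepFam.SpanDense B)
    (hlevel : SepFam.ContinuousConvexLevels B Γ)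
    (hloc : SepFam.LocallyNonconstant B φ xs N Γ)
    -- the assumptions on `E₀`, for the same `B`, `Γ` and the same normed space `(F, N)`
    (hnorm₀ : ∃ xs₀ : E₀, SepFam.DominatingNorm (ι ⁻¹' B) xs₀ (N ∘ ι))
    (hcone₀ : SepFam.ConeDecomposition (ι ⁻¹' B))
    (hdense₀ : SepFam.SpanDense (ι ⁻¹' B))
    (hsep₀ : TopologicalSpace.SeparableSpace (StrongDual ℝ E₀))
    (hlevel₀ : SepFam.ContinuousConvexLevels (ι ⁻¹' B) (Γ ∘ ι))
    (hborel₀ : SepFam.BorelPreimage (ι ⁻¹' B) (Γ ∘ ι)) :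
    ∃ (z : SepFam.levelRange B Γ → StrongDual ℝ E)
      (z₀ : SepFam.levelRange B Γ → StrongDual ℝ E₀),
      SepFam.IsTheSeparatingFamily B Γ z ∧
      SepFam.IsTheSeparatingFamily (ι ⁻¹' B) (Γ ∘ ι) z₀ ∧
      Measurable[SepFam.lebesgueCompletion (SepFam.levelRange B Γ), borel (StrongDual ℝ E₀)] z₀ ∧
      StronglyMeasurable[SepFam.lebesgueCompletion (SepFam.levelRange B Γ)] z₀ ∧
      ∃ α : SepFam.levelRange B Γ → ℝ,
        Measurable[SepFam.lebesgueCompletion (SepFam.levelRange B Γ), borel ℝ] α ∧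
        ∀ r, 0 < α r ∧ (z r).comp ι = α r • z₀ r := by
  have hle : (inferInstance : MeasurableSpace (levelRange B Γ)) ≤
      lebesgueCompletion (levelRange B Γ) := le_eventuallyMeasurableSpace
  have hI : ∀ r : levelRange B Γ, (∃ x ∈ B, Γ x < r) ∧ ∃ x ∈ B, r < Γ x := fun r => by
    simpa using exists_lt_and_gt_of_mem_interior r.2
  have hI₀ : ∀ r : levelRange B Γ,
      (∃ x ∈ ι ⁻¹' B, (Γ ∘ ι) x < r) ∧ ∃ x ∈ ι ⁻¹' B, r < (Γ ∘ ι) x := by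
    intro r
    obtain ⟨⟨x, hx, hxr⟩, ⟨y, hy, hyr⟩⟩ := hI r
    obtain ⟨x, rfl⟩ := hBE₀ hx
    obtain ⟨y, rfl⟩ := hBE₀ hy
    exact ⟨⟨x, hx, hxr⟩, ⟨y, hy, hyr⟩⟩
  have hface₀ : SimplexFace (ι ⁻¹' B) (φ.comp ι) := fun x hx => hface (ι x) hx
  have hBconv₀ : Convex ℝ (ι ⁻¹' B) := hBconv.linear_preimage (ι : E₀ →ₗ[ℝ] E)
  choose ζ hζ using fun r : levelRange B Γ =>
    exists_separates hBconv hface hnorm hlevel hloc r.2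
  obtain ⟨z, hz, hzs, hzn⟩ := exists_isTheSeparatingFamily hBconv hface hcone hdense
    hlevel.continuousOn hI hζ
  have hζ₀ : ∀ r : levelRange B Γ,
      Separates (ι ⁻¹' B) (Γ ∘ ι) r ((z r).comp ι : E₀ →ₗ[ℝ] ℝ) :=
    fun r => (hzs r).comp (ι : E₀ →ₗ[ℝ] E)
  obtain ⟨z₀, hz₀, hz₀s, hz₀n⟩ := exists_isTheSeparatingFamily hBconv₀ hface₀ hcone₀ hdense₀
    hlevel₀.continuousOn hI₀ hζ₀
  have hap : ∀ p : E, Measurable fun r => z r p :=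
    measurable_apply hdense (fun u hu => isOpen_setOf_pos hBconv hcone hI hzs hu) hzn
  have hap₀ : ∀ p : E₀, Measurable fun r => z₀ r p :=
    measurable_apply hdense₀ (fun u hu => isOpen_setOf_pos hBconv₀ hcone₀ hI₀ hz₀s hu) hz₀n
  have hsm : StronglyMeasurable z₀ := stronglyMeasurable_of_measurable_apply hap₀
  have hα : Measurable fun r => ‖(z r).comp ι‖ :=
    measurable_norm_of_measurable_apply fun u => hap (ι u)
  refine ⟨z, z₀, hz, hz₀, ?_, hsm.mono hle, fun r => ‖(z r).comp ι‖, ?_, fun r => ?_⟩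
  · borelize (StrongDual ℝ E₀)
    exact hsm.measurable.mono hle le_rfl
  · exact hα.mono hle BorelSpace.measurable_eq.ge
  · obtain ⟨c, hc, hcw⟩ := (hz₀s r).exists_pos_mul_eq hBconv₀ (hζ₀ r) (hI₀ r).1 (hI₀ r).2
    have heq : (z r).comp ι = c • z₀ r := eq_of_eqOn_span hdense₀ hcw
    have hnc : ‖(z r).comp ι‖ = c := by
      rw [heq, norm_pos_smul hc, hz₀n, mul_one]
    simp only [hnc]
    exact ⟨hc, heq⟩
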